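/- Let $\alpha$ be a probability measure on the Borel sets of $\mathbb{R}$ that is symmetric about $0$, has finite moments of all orders, has infinite support, and satisfies $\alpha(\{0\})=0$. Let $\alpha_+$ be the push-forward of $\alpha$ under $t\mapsto t^2$, a probability measure concentrated on $[0,\infty)$ and regarded as a measure on $\mathbb{R}$, and let $b_k=\int t^k\,d\alpha_+(t)=\int t^{2k}\,d\alpha(t)$, $k=0,1,2,\dots$, be its moments. Define the Hankel determinants $$H_n=\det\big[(b_{i+j})_{i,j=0}^n\big],\qquad G_n=\det\big[(b_{i+j})_{i,j=1}^n\big]\qquad (G_0=1).$$ Then $G_n\neq 0$ for all $n$, and the Hamburger moment problem for $\alpha_+$ is determinate (that is, $\alpha_+$ is the only Borel measure $\nu$ on $\mathbb{R}$ with finite moments of all orders such that $\int t^k\,d\nu(t)=b_k$ for all $k=0,1,2,\dots$) if and only if $$\lim_{n\to\infty}\frac{H_n}{G_n}=0 .$$ -/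

import Mathlib

open MeasureTheory Filter Topology

noncomputable section

/-- The push-forward `α₊` of a measure `α` on `ℝ` under `t ↦ t ^ 2`. It is carried by `[0, ∞)` and
is regarded as a measure on `ℝ`. -/
def squarePushforward (α : Measure ℝ) : Measure ℝ :=
  α.map (fun t : ℝ => t ^ 2)

/-- The `k`-th moment `∫ t ^ k dμ(t)` of a measure on `ℝ`. -/
def measureMoment (μ : Measure ℝ) (k : ℕ) : ℝ :=
  ∫ t : ℝ, t ^ k ∂μ

/-- `ν` solves the Hamburger moment problem for the real sequence `s = (s₀, s₁, …)`: all its moments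
exist and its `k`-th moment is `s k`. (For `k = 0` this says that `ν` is finite, of mass `s 0`.) -/
def IsHamburgerSolution (s : ℕ → ℝ) (ν : Measure ℝ) : Prop :=
  ∀ k : ℕ, Integrable (fun t : ℝ => t ^ k) ν ∧ measureMoment ν k = s k

/-- The Hamburger moment problem for the measure `μ` is determinate: there is exactly one Borel
measure on the whole line that has the same moments as `μ`. -/
def IsHamburgerDeterminate (μ : Measure ℝ) : Prop :=
  ∃! ν : Measure ℝ, IsHamburgerSolution (measureMoment μ) ν

/-- The Hankel determinant `H_n = det (b_{i+j})_{i,j=0}^n`. -/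
def hankelH (b : ℕ → ℝ) (n : ℕ) : ℝ :=
  (Matrix.of fun i j : Fin (n + 1) => b ((i : ℕ) + (j : ℕ))).det

/-- The Hankel determinant `G_n = det (b_{i+j})_{i,j=1}^n` (with `G_0 = 1`); the indices of `Fin n`
start at `0`, hence the shifts by one. -/
def hankelG (b : ℕ → ℝ) (n : ℕ) : ℝ :=
  (Matrix.of fun i j : Fin n => b (((i : ℕ) + 1) + ((j : ℕ) + 1))).det

end

/-! Let `L p = ∫ p dα₊`. Since `α` has infinite support, `L (p * p) > 0` for `p ≠ 0`, so all Hankel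
determinants are positive. By Cramer's rule `G_n / H_n` is the corner entry of the inverse Hankel
matrix, which is the value at `0` of the polynomial of degree at most `n` reproducing evaluation at
`0`. Hence `H_n / G_n` is the minimum of `L (p * p)` over such degrees with `p(0) = 1`, and it tends
to `0` exactly when evaluation at `0` is unbounded on polynomials in `L²(α₊)`
(`tendsto_hankel_div_iff`). It remains to match this with determinacy.

If `ε p(0)² ≤ L (p * p)`, then `L - ε δ₀` is still nonnegative on squares, so Hamburger's theorem
represents it by a measure `ν`. Now `ν + ε δ₀` has the moments of `α₊` and an atom at `0`, while
`α({0}) = 0` excludes such an atom of `α₊` (`not_isHamburgerDeterminate_of_eval_sq_le`).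

Conversely, a second solution has a different Stieltjes transform at some `z` in the upper
half-plane. Comparing `∫ p(t) / (t - z)` for the two measures, the difference quotients cancel and
`p(z)` times a nonzero number remains, so evaluation at `z` is bounded. The orthonormal polynomials
and those of the second kind are then square summable at `z`, and a discrete Grönwall inequality
carries square summability of the former to every real point, in particular to `0`
(`exists_eval_sq_le_of_ne`). -/

/-! ### Hamburger's existence theorem, by M. Riesz extension. -/

open Polynomial in
/-- A real polynomial that is nonnegative on the line is a sum of squares. -/
theorem Polynomial.isSumSq_of_forall_eval_nonneg (p : ℝ[X]) (hp : ∀ t, 0 ≤ p.eval t) :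
    IsSumSq p := by
  induction hn : p.natDegree using Nat.strong_induction_on generalizing p with
  | _ n ih =>
    obtain ⟨a, ha⟩ := p.exists_forall_norm_le
    have hmin : ∀ t, p.eval a ≤ p.eval t := fun t => by
      simpa [abs_of_nonneg (hp _)] using ha t
    have hC : IsSumSq (C (p.eval a)) := by
      rw [← Real.mul_self_sqrt (hp a), C_mul]
      exact IsSumSq.mul_self _
    by_cases hn0 : n = 0
    · rw [hn0] at hn
      rw [eq_C_of_natDegree_eq_zero hn] at hC ⊢
      simpa using hC
    obtain ⟨r, hr⟩ : X - C a ∣ p - C (p.eval a) := by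
      rw [dvd_iff_isRoot]; simp
    -- The root at the minimum point `a` is double because the derivative vanishes there.
    have hr0 : r.eval a = 0 := by
      have h1 : IsLocalMin (fun t => p.eval t) a := Eventually.of_forall hmin
      have h2 := h1.deriv_eq_zero
      rw [Polynomial.deriv] at h2
      have h3 : derivative p = derivative ((X - C a) * r) := by
        rw [← hr]; simp
      rw [h3] at h2
      simpa using h2
    obtain ⟨q, hq⟩ : X - C a ∣ r := by rwa [dvd_iff_isRoot]
    have hpq : p = C (p.eval a) + (X - C a) * (X - C a) * q := by
      rw [mul_assoc, ← hq, ← hr]; ring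
    -- Clear off `a` by division; the value at `a` follows by density.
    have hq0 : ∀ t, 0 ≤ q.eval t := by
      have hcl : IsClosed {t : ℝ | 0 ≤ q.eval t} := isClosed_le continuous_const q.continuous
      have hsub : ({a}ᶜ : Set ℝ) ⊆ {t : ℝ | 0 ≤ q.eval t} := by
        intro t ht
        have h1 := hmin t
        have h2 := congrArg (eval t) hpq
        simp only [eval_add, eval_C, eval_mul, eval_sub, eval_X] at h2
        have h3 : 0 < (t - a) * (t - a) := mul_self_pos.2 (sub_ne_zero.2 ht)
        have h4 : 0 ≤ (t - a) * (t - a) * q.eval t := by linarith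
        exact nonneg_of_mul_nonneg_right h4 h3
      intro t
      have h5 := (dense_compl_singleton a).closure_eq ▸ closure_minimal hsub hcl
      exact h5 (Set.mem_univ t)
    have hqd : q.natDegree < n := by
      by_cases hqz : q = 0
      · rw [hqz]; simpa using Nat.pos_of_ne_zero hn0
      have h1 : ((X - C a) * (X - C a) * q).natDegree = 2 + q.natDegree := by
        rw [natDegree_mul (mul_ne_zero (X_sub_C_ne_zero a) (X_sub_C_ne_zero a)) hqz,
          natDegree_mul (X_sub_C_ne_zero a) (X_sub_C_ne_zero a), natDegree_X_sub_C]
      have h2 : (p - C (p.eval a)).natDegree = 2 + q.natDegree := by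
        rw [← h1, mul_assoc, ← hq, ← hr]
      rw [natDegree_sub_C, hn] at h2
      omega
    rw [hpq]
    exact hC.add ((IsSumSq.mul_self _).mul (ih _ hqd q hq0 rfl))

open Polynomial in
/-- A linear functional that is nonnegative on squares is nonnegative on nonnegative
polynomials. -/
theorem Polynomial.nonneg_of_forall_eval_nonneg (Λ : ℝ[X] →ₗ[ℝ] ℝ)
    (hΛ : ∀ q, 0 ≤ Λ (q * q)) (p : ℝ[X]) (hp : ∀ t, 0 ≤ p.eval t) : 0 ≤ Λ p := by
  have key : ∀ s : ℝ[X], IsSumSq s → 0 ≤ Λ s := by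
    intro s hs
    induction hs with
    | zero => simp
    | sq_add a _ ih => rw [map_add]; exact add_nonneg (hΛ a) ih
  exact key p (isSumSq_of_forall_eval_nonneg p hp)

/-- A continuous cutoff function, equal to `1` on `[-R, R]` and to `0` off `[-R-1, R+1]`. -/
noncomputable def cutoff (R : ℝ) : CompactlySupportedContinuousMap ℝ ℝ where
  toFun t := max 0 (min 1 (R + 1 - |t|))
  continuous_toFun := by fun_prop
  hasCompactSupport' := by
    refine HasCompactSupport.intro (isCompact_Icc (a := -(R + 1)) (b := R + 1)) fun t ht => ?_
    rw [Set.mem_Icc, ← abs_le] at ht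
    exact max_eq_left ((min_le_right _ _).trans (by linarith))

theorem cutoff_nonneg (R t : ℝ) : 0 ≤ cutoff R t := le_max_left _ _

theorem cutoff_le_one (R t : ℝ) : cutoff R t ≤ 1 := max_le zero_le_one (min_le_left _ _)

theorem cutoff_eq_one {R t : ℝ} (h : |t| ≤ R) : cutoff R t = 1 := by
  change max 0 (min 1 (R + 1 - |t|)) = 1
  rw [min_eq_left (by linarith)]; simp

open Polynomial in
/-- The cone of pairs `(p, f)` of a polynomial and a compactly supported function with
`0 ≤ p + f`. -/
noncomputable def nonnegPairCone :
    PointedCone ℝ (ℝ[X] × CompactlySupportedContinuousMap ℝ ℝ) where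
  carrier := {x | ∀ t : ℝ, 0 ≤ x.1.eval t + x.2 t}
  add_mem' := by
    intro x y hx hy t
    have := add_nonneg (hx t) (hy t)
    simp only [Prod.fst_add, Prod.snd_add, eval_add, CompactlySupportedContinuousMap.coe_add,
      Pi.add_apply]
    linarith
  zero_mem' := by intro t; simp
  smul_mem' := by
    intro c x hx t
    have := mul_nonneg c.2 (hx t)
    have e : (c • x).1.eval t + (c • x).2 t = c * (x.1.eval t + x.2 t) := by
      rw [mul_add]
      congr 1
      exact eval_smul (c : ℝ) x.1 t
    rwa [e]

open Polynomial in
/-- M. Riesz extension of a positive functional on polynomials to compactly supported functions. -/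
theorem exists_extension_compactlySupported (Λ : ℝ[X] →ₗ[ℝ] ℝ)
    (hΛ : ∀ p : ℝ[X], (∀ t, 0 ≤ p.eval t) → 0 ≤ Λ p) :
    ∃ φ : CompactlySupportedContinuousMap ℝ ℝ →ₗ[ℝ] ℝ,
      ∀ p f, (∀ t : ℝ, 0 ≤ p.eval t + f t) → 0 ≤ Λ p + φ f := by
  let F : (ℝ[X] × CompactlySupportedContinuousMap ℝ ℝ) →ₗ.[ℝ] ℝ :=
    ⟨LinearMap.ker (LinearMap.snd ℝ _ _), (Λ ∘ₗ LinearMap.fst ℝ _ _).domRestrict _⟩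
  obtain ⟨g, hg, hpos⟩ := riesz_extension nonnegPairCone F (by
      rintro ⟨⟨p, f⟩, hf⟩ h
      have hf' : f = 0 := hf
      subst hf'
      refine hΛ p fun t => ?_
      simpa using h t) (by
      rintro ⟨p, f⟩
      obtain ⟨M, hM⟩ := f.hasCompactSupport.exists_bound_of_continuous f.continuous
      -- Cofinality: adding this polynomial turns `p + f` into `M + f ≥ 0`, where `M` bounds `|f|`.
      refine ⟨⟨(C M - p, 0), by simp [F]⟩, fun t => ?_⟩
      have := neg_le_of_abs_le (hM t)
      simp
      linarith)
  refine ⟨g ∘ₗ LinearMap.inr ℝ _ _, fun p f h => ?_⟩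
  have h1 : g (p, 0) = Λ p := hg ⟨(p, 0), by simp [F]⟩
  have h2 := hpos (p, f) h
  have h3 : ((p, f) : ℝ[X] × CompactlySupportedContinuousMap ℝ ℝ) = (p, 0) + (0, f) := by simp
  rw [h3, map_add, h1] at h2
  exact h2

open Polynomial in
/-- Hamburger's theorem: a linear functional on real polynomials that is nonnegative on squares is
integration against a measure. -/
theorem exists_measure_of_nonneg_on_squares (Λ : ℝ[X] →ₗ[ℝ] ℝ) (hΛ : ∀ q, 0 ≤ Λ (q * q)) :
    ∃ ν : Measure ℝ, ∀ k : ℕ, Integrable (fun t : ℝ => t ^ k) ν ∧ ∫ t, t ^ k ∂ν = Λ (X ^ k) := by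
  obtain ⟨φ, hφ⟩ := exists_extension_compactlySupported Λ
    (fun p hp => nonneg_of_forall_eval_nonneg Λ hΛ p hp)
  have hφ0 : ∀ f : CompactlySupportedContinuousMap ℝ ℝ, 0 ≤ f → 0 ≤ φ f := fun f hf => by
    simpa using hφ 0 f (fun t => by simpa using hf t)
  let Φ : CompactlySupportedContinuousMap ℝ ℝ →ₚ[ℝ] ℝ := PositiveLinearMap.mk₀ φ hφ0
  let ν := RealRMK.rieszMeasure Φ
  have hν : ∀ f : CompactlySupportedContinuousMap ℝ ℝ, ∫ x, f x ∂ν = φ f :=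
    fun f => RealRMK.integral_rieszMeasure Φ f
  let T : ℕ → ℕ → CompactlySupportedContinuousMap ℝ ℝ := fun k N =>
    ⟨⟨fun t => cutoff N t * t ^ k, by fun_prop⟩, (cutoff N).hasCompactSupport.mul_right⟩
  have hT : ∀ k N t, T k N t = cutoff N t * t ^ k := fun _ _ _ => rfl
  have hTlim : ∀ k t, Tendsto (fun N => T k N t) atTop (𝓝 (t ^ k)) := by
    intro k t
    refine tendsto_const_nhds.congr' ?_
    filter_upwards [eventually_ge_atTop ⌈|t|⌉₊] with N hN
    rw [hT, cutoff_eq_one (Nat.ceil_le.1 hN), one_mul]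
  -- Fatou's lemma: the truncations lie below `t ^ (2 * k)`, so positivity bounds their integrals
  -- uniformly.
  have heven : ∀ k, Integrable (fun t : ℝ => t ^ (2 * k)) ν := by
    intro k
    have hnn : ∀ N t, 0 ≤ T (2 * k) N t := fun N t =>
      mul_nonneg (cutoff_nonneg _ _) ((even_two_mul k).pow_nonneg t)
    have hbd : ∀ N, ∫ t, T (2 * k) N t ∂ν ≤ Λ (X ^ (2 * k)) := by
      intro N
      rw [hν]
      have := hφ (X ^ (2 * k)) (-T (2 * k) N) (fun t => by
        have h1 := cutoff_le_one N t
        have h2 := (even_two_mul k).pow_nonneg t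
        simp only [eval_pow, eval_X, CompactlySupportedContinuousMap.coe_neg, Pi.neg_apply, hT]
        nlinarith)
      rw [map_neg] at this
      linarith
    refine ⟨by fun_prop, ?_⟩
    rw [hasFiniteIntegral_iff_ofReal (Eventually.of_forall fun t => (even_two_mul k).pow_nonneg t)]
    have hl : ∫⁻ t, ENNReal.ofReal (t ^ (2 * k)) ∂ν
        ≤ liminf (fun N => ∫⁻ t, ENNReal.ofReal (T (2 * k) N t) ∂ν) atTop := by
      refine le_trans (lintegral_mono fun t => ?_)
        (lintegral_liminf_le fun N => (T (2 * k) N).continuous.measurable.ennreal_ofReal)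
      exact (((ENNReal.continuous_ofReal.tendsto _).comp (hTlim (2 * k) t)).liminf_eq).ge
    refine lt_of_le_of_lt (hl.trans ?_) (ENNReal.ofReal_lt_top (r := Λ (X ^ (2 * k))))
    refine liminf_le_of_le (by isBoundedDefault) fun b hb => ?_
    obtain ⟨N, hN⟩ := hb.exists
    refine hN.trans ?_
    rw [← ofReal_integral_eq_lintegral_ofReal (f := fun t => T (2 * k) N t)
      ((T (2 * k) N).continuous.integrable_of_hasCompactSupport (T (2 * k) N).hasCompactSupport)
      (Eventually.of_forall (hnn N))]
    exact ENNReal.ofReal_le_ofReal (hbd N)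
  have hint : ∀ k, Integrable (fun t : ℝ => t ^ k) ν := by
    intro k
    refine ((heven 0).add (heven k)).mono' (by fun_prop) (Eventually.of_forall fun t => ?_)
    simp only [Pi.add_apply, mul_zero, pow_zero, norm_pow, Real.norm_eq_abs]
    rw [pow_mul', ← sq_abs (t ^ k), abs_pow]
    nlinarith [sq_nonneg (|t| ^ k - 1), pow_nonneg (abs_nonneg t) k]
  refine ⟨ν, fun k => ⟨hint k, ?_⟩⟩
  have hlim1 : Tendsto (fun N => φ (T k N)) atTop (𝓝 (∫ t, t ^ k ∂ν)) := by
    simp_rw [← hν]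
    refine tendsto_integral_of_dominated_convergence (fun t => ‖t ^ k‖)
      (fun N => (T k N).continuous.aestronglyMeasurable) (hint k).norm ?_
      (Eventually.of_forall (hTlim k))
    intro N
    refine Eventually.of_forall fun t => ?_
    rw [hT, norm_mul, Real.norm_of_nonneg (cutoff_nonneg _ _)]
    exact mul_le_of_le_one_left (norm_nonneg _) (cutoff_le_one _ _)
  -- No moment escapes to infinity: the truncation error vanishes on `[-N, N]` and elsewhere is at
  -- most `|t| ^ k ≤ N⁻¹ t ^ (2 * (k + 1))`. Positivity of the extension on pairs turns this into a
  -- bound on the functionals.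
  have hlim2 : Tendsto (fun N => φ (T k N)) atTop (𝓝 (Λ (X ^ k))) := by
    have hb : ∀ N : ℕ, 1 ≤ N →
        |φ (T k N) - Λ (X ^ k)| ≤ Λ (X ^ (2 * (k + 1))) * (N : ℝ)⁻¹ := by
      intro N hN
      have hN' : (1 : ℝ) ≤ N := by exact_mod_cast hN
      have hpt : ∀ t : ℝ, |T k N t - t ^ k| ≤ (N : ℝ)⁻¹ * t ^ (2 * (k + 1)) := by
        intro t
        have he := (even_two_mul (k + 1)).pow_nonneg t
        rw [hT]
        by_cases ht : |t| ≤ N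
        · rw [cutoff_eq_one ht]
          simp only [one_mul, sub_self, abs_zero]
          positivity
        · push Not at ht
          have h1 : |cutoff N t * t ^ k - t ^ k| ≤ |t| ^ k := by
            rw [← sub_one_mul, abs_mul, abs_pow]
            refine mul_le_of_le_one_left (by positivity) ?_
            rw [abs_le]
            constructor <;> linarith [cutoff_nonneg N t, cutoff_le_one N t]
          refine h1.trans ?_
          rw [inv_mul_eq_div, le_div_iff₀ (by linarith), ← (even_two_mul (k + 1)).pow_abs]
          calc |t| ^ k * N ≤ |t| ^ k * |t| := by gcongr
            _ = |t| ^ (k + 1) := (pow_succ _ _).symm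
            _ ≤ |t| ^ (2 * (k + 1)) := pow_le_pow_right₀ (by linarith) (by omega)
      have e1 := hφ (C ((N : ℝ)⁻¹) * X ^ (2 * (k + 1)) - X ^ k) (T k N) (fun t => by
        have := (abs_le.1 (hpt t)).1
        simp only [eval_sub, eval_mul, eval_C, eval_pow, eval_X]
        linarith)
      have e2 := hφ (C ((N : ℝ)⁻¹) * X ^ (2 * (k + 1)) + X ^ k) (-T k N) (fun t => by
        have := (abs_le.1 (hpt t)).2
        simp only [eval_add, eval_mul, eval_C, eval_pow, eval_X,
          CompactlySupportedContinuousMap.coe_neg, Pi.neg_apply]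
        linarith)
      rw [C_mul', map_sub, map_smul, smul_eq_mul] at e1
      rw [C_mul', map_add, map_smul, smul_eq_mul, map_neg] at e2
      rw [abs_le]
      constructor <;> linarith
    rw [tendsto_iff_norm_sub_tendsto_zero]
    refine squeeze_zero' (Eventually.of_forall fun _ => norm_nonneg _)
      ((eventually_ge_atTop 1).mono hb) ?_
    simpa using (tendsto_inv_atTop_nhds_zero_nat (𝕜 := ℝ)).const_mul (Λ (X ^ (2 * (k + 1))))
  exact tendsto_nhds_unique hlim1 hlim2

/-! ### Stieltjes inversion through Poisson averages. -/

theorem lintegral_eq_lintegral_add_mul {y : ℝ} (hy : 0 < y) (t : ℝ) {g : ℝ → ENNReal}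
    (hg : Measurable g) :
    ∫⁻ x, g x = ∫⁻ u, ENNReal.ofReal y * g (t + y * u) := by
  rw [← lintegral_add_left_eq_self g t]
  nth_rewrite 1 [← Real.smul_map_volume_mul_left hy.ne']
  rw [lintegral_smul_measure, lintegral_map (by fun_prop) (by fun_prop), abs_of_pos hy,
    lintegral_const_mul _ (by fun_prop), smul_eq_mul]

/-- The Poisson average at height `y` of a function against a measure, written without the Poisson
kernel. -/
theorem lintegral_poisson {μ : Measure ℝ} [IsFiniteMeasure μ] {y : ℝ} (hy : 0 < y)
    {f : ℝ → ENNReal} (hf : Measurable f) :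
    ∫⁻ t, (∫⁻ u, f (t + y * u) * ENNReal.ofReal (1 + u ^ 2)⁻¹) ∂μ
      = ∫⁻ x, f x * ∫⁻ t, ENNReal.ofReal (y / ((t - x) ^ 2 + y ^ 2)) ∂μ := by
  have h1 : ∀ t, ∫⁻ u, f (t + y * u) * ENNReal.ofReal (1 + u ^ 2)⁻¹
      = ∫⁻ x, f x * ENNReal.ofReal (y / ((t - x) ^ 2 + y ^ 2)) := by
    intro t
    rw [lintegral_eq_lintegral_add_mul hy t
      (g := fun x => f x * ENNReal.ofReal (y / ((t - x) ^ 2 + y ^ 2))) (by fun_prop)]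
    refine lintegral_congr fun u => ?_
    rw [mul_left_comm, ← ENNReal.ofReal_mul hy.le]
    congr 2
    have : 1 + u ^ 2 ≠ 0 := by positivity
    have e : (t - (t + y * u)) ^ 2 + y ^ 2 = y ^ 2 * (1 + u ^ 2) := by ring
    rw [e]
    field_simp
  simp_rw [h1]
  rw [lintegral_lintegral_swap (by fun_prop)]
  exact lintegral_congr fun x => lintegral_const_mul _ (by fun_prop)

/-- In the rescaled variable `u` the kernel is fixed and the height `1 / (n + 1)` enters only
through the continuous bounded `f`, so dominated convergence applies in `u` and then in `t`. -/
theorem tendsto_lintegral_poisson (μ : Measure ℝ) [IsFiniteMeasure μ]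
    (f : BoundedContinuousFunction ℝ NNReal) :
    Tendsto (fun n : ℕ => ∫⁻ t, (∫⁻ u, (f (t + (1 / ((n : ℝ) + 1)) * u) : ENNReal)
        * ENNReal.ofReal (1 + u ^ 2)⁻¹) ∂μ) atTop
      (𝓝 ((∫⁻ t, f t ∂μ) * ∫⁻ u : ℝ, ENNReal.ofReal (1 + u ^ 2)⁻¹)) := by
  obtain ⟨M, hM⟩ : ∃ M : NNReal, ∀ x, f x ≤ M := ⟨_, BoundedContinuousFunction.NNReal.upper_bound f⟩
  have hfin : ∫⁻ u : ℝ, ENNReal.ofReal (1 + u ^ 2)⁻¹ ≠ ⊤ :=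
    integrable_inv_one_add_sq.lintegral_lt_top.ne
  have hle : ∀ t u, (f t : ENNReal) * ENNReal.ofReal (1 + u ^ 2)⁻¹
      ≤ M * ENNReal.ofReal (1 + u ^ 2)⁻¹ := fun t u => by
    gcongr; exact hM t
  have hfm : Measurable fun t => (f t : ENNReal) := f.continuous.measurable.coe_nnreal_ennreal
  rw [← lintegral_mul_const _ hfm]
  refine tendsto_lintegral_of_dominated_convergence
    (fun _ => M * ∫⁻ u : ℝ, ENNReal.ofReal (1 + u ^ 2)⁻¹)
    (fun n => Measurable.lintegral_prod_right'
      (f := fun p : ℝ × ℝ => (f (p.1 + (1 / ((n : ℝ) + 1)) * p.2) : ENNReal)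
        * ENNReal.ofReal (1 + p.2 ^ 2)⁻¹) (by fun_prop)) (fun n => Eventually.of_forall fun t => ?_) ?_
    (Eventually.of_forall fun t => ?_)
  · rw [← lintegral_const_mul _ (by fun_prop)]
    exact lintegral_mono fun u => hle _ u
  · rw [lintegral_const]
    exact ENNReal.mul_ne_top (ENNReal.mul_ne_top ENNReal.coe_ne_top hfin) (measure_ne_top _ _)
  · rw [← lintegral_const_mul _ (by fun_prop)]
    refine tendsto_lintegral_of_dominated_convergence
      (fun u => M * ENNReal.ofReal (1 + u ^ 2)⁻¹) (fun n => by fun_prop)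
      (fun n => Eventually.of_forall fun u => hle _ u) ?_ (Eventually.of_forall fun u => ?_)
    · rw [lintegral_const_mul _ (by fun_prop)]
      exact ENNReal.mul_ne_top ENNReal.coe_ne_top hfin
    · refine ENNReal.Tendsto.mul_const ?_ (Or.inr ENNReal.ofReal_ne_top)
      have h1 : Tendsto (fun n : ℕ => t + (1 / ((n : ℝ) + 1)) * u) atTop (𝓝 (t + 0 * u)) :=
        (tendsto_one_div_add_atTop_nhds_zero_nat.mul_const u).const_add t
      rw [zero_mul, add_zero] at h1
      exact ENNReal.tendsto_coe.2 ((f.continuous.tendsto t).comp h1)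

theorem norm_inv_ofReal_sub_le (t : ℝ) {z : ℂ} (hz : 0 < z.im) :
    ‖((t : ℂ) - z)⁻¹‖ ≤ z.im⁻¹ := by
  rw [norm_inv]
  refine inv_anti₀ hz ?_
  have := Complex.abs_im_le_norm ((t : ℂ) - z)
  simpa [abs_of_pos hz] using this

theorem integrable_inv_ofReal_sub (μ : Measure ℝ) [IsFiniteMeasure μ] {z : ℂ} (hz : 0 < z.im) :
    Integrable (fun t : ℝ => ((t : ℂ) - z)⁻¹) μ :=
  Integrable.of_bound (by fun_prop) z.im⁻¹
    (Eventually.of_forall fun t => norm_inv_ofReal_sub_le t hz)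

/-- A finite measure on the line is determined by its Stieltjes transform. -/
theorem MeasureTheory.Measure.ext_of_stieltjes {μ ν : Measure ℝ} [IsFiniteMeasure μ] [IsFiniteMeasure ν]
    (h : ∀ z : ℂ, 0 < z.im → ∫ t : ℝ, ((t : ℂ) - z)⁻¹ ∂μ = ∫ t : ℝ, ((t : ℂ) - z)⁻¹ ∂ν) :
    μ = ν := by
  -- The Poisson integral is the imaginary part of the Stieltjes transform.
  have key : ∀ (ρ : Measure ℝ) [IsFiniteMeasure ρ] (x y : ℝ), 0 < y →
      ∫⁻ t, ENNReal.ofReal (y / ((t - x) ^ 2 + y ^ 2)) ∂ρ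
        = ENNReal.ofReal (∫ t : ℝ, ((t : ℂ) - ⟨x, y⟩)⁻¹ ∂ρ).im := by
    intro ρ _ x y hy
    have hi := integrable_inv_ofReal_sub ρ (z := ⟨x, y⟩) hy
    have e : ∀ t : ℝ, (((t : ℂ) - ⟨x, y⟩)⁻¹).im = y / ((t - x) ^ 2 + y ^ 2) := by
      intro t
      simp [Complex.inv_im, Complex.normSq_apply, sq]
    have h1 : (∫ t : ℝ, ((t : ℂ) - ⟨x, y⟩)⁻¹ ∂ρ).im
        = ∫ t : ℝ, (((t : ℂ) - ⟨x, y⟩)⁻¹).im ∂ρ := (Complex.imCLM.integral_comp_comm hi).symm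
    have h2 : Integrable (fun t : ℝ => (((t : ℂ) - ⟨x, y⟩)⁻¹).im) ρ :=
      Complex.imCLM.integrable_comp hi
    simp_rw [e] at h1 h2
    rw [h1, ofReal_integral_eq_lintegral_ofReal h2 (Eventually.of_forall fun t => by positivity)]
  refine ext_of_forall_lintegral_eq_of_IsFiniteMeasure fun f => ?_
  -- This constant is `π`; being nonzero and finite, it can be cancelled from both limits.
  have hC0 : ∫⁻ u : ℝ, ENNReal.ofReal (1 + u ^ 2)⁻¹ ≠ 0 := by
    rw [← ofReal_integral_eq_lintegral_ofReal integrable_inv_one_add_sq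
      (Eventually.of_forall fun t => by positivity), integral_univ_inv_one_add_sq]
    simpa using Real.pi_pos
  refine (ENNReal.mul_left_inj hC0 integrable_inv_one_add_sq.lintegral_lt_top.ne).1 ?_
  refine tendsto_nhds_unique (tendsto_lintegral_poisson μ f) ?_
  refine (tendsto_lintegral_poisson ν f).congr fun n => ?_
  have hn : (0 : ℝ) < 1 / ((n : ℝ) + 1) := by positivity
  have hfm : Measurable fun t => (f t : ENNReal) := f.continuous.measurable.coe_nnreal_ennreal
  rw [lintegral_poisson hn hfm, lintegral_poisson hn hfm]
  refine lintegral_congr fun x => ?_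
  rw [key μ x _ hn, key ν x _ hn, h _ hn]

/-! ### Orthonormal polynomials and their dependence on the point. -/

section OrthogonalPolynomials

open Polynomial

theorem Polynomial.exists_orthonormal (L : ℝ[X] →ₗ[ℝ] ℝ) (hL : ∀ p, p ≠ 0 → 0 < L (p * p)) :
    ∃ P : ℕ → ℝ[X], (∀ n, (P n).degree = n) ∧
      ∀ m n, L (P m * P n) = if m = n then 1 else 0 := by
  let core : InnerProductSpace.Core ℝ ℝ[X] :=
    { inner := fun p q => L (p * q)
      conj_inner_symm := fun p q => by simp [mul_comm]
      re_inner_nonneg := fun p => by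
        by_cases hp : p = 0
        · simp [hp]
        · exact (hL p hp).le
      add_left := fun p q r => by simp [add_mul]
      smul_left := fun p q r => by simp
      definite := fun p hp => by
        by_contra h
        exact (hL p h).ne' hp }
  let _ := core.toNormedAddCommGroup
  let _ := InnerProductSpace.ofCore core.toCore
  have hinner : ∀ p q : ℝ[X], inner ℝ p q = L (p * q) := fun _ _ => rfl
  let f : ℕ → ℝ[X] := fun n => X ^ n
  have hgs : ∀ n, (InnerProductSpace.gramSchmidt ℝ f n).degree = n := by
    intro n
    induction n using Nat.strong_induction_on with
    | _ n ih =>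
      have h := InnerProductSpace.gramSchmidt_def'' ℝ f n
      rw [← sub_eq_iff_eq_add] at h
      rw [← h]
      have hlt : (∑ i ∈ Finset.Iio n, (inner ℝ (InnerProductSpace.gramSchmidt ℝ f i) (f n) /
          ((‖InnerProductSpace.gramSchmidt ℝ f i‖ : ℝ)) ^ 2) •
            InnerProductSpace.gramSchmidt ℝ f i).degree < n := by
        refine mem_degreeLT.1 (Submodule.sum_mem _ fun i hi => Submodule.smul_mem _ _ ?_)
        rw [mem_degreeLT, ih i (Finset.mem_Iio.1 hi)]
        exact_mod_cast Finset.mem_Iio.1 hi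
      exact (degree_sub_eq_left_of_degree_lt (by simpa [f] using hlt)).trans (degree_X_pow n)
  have hne : ∀ n, InnerProductSpace.gramSchmidt ℝ f n ≠ 0 := fun n h0 => by
    have := hgs n
    rw [h0] at this
    simp at this
  have hn : ∀ n, ‖InnerProductSpace.gramSchmidt ℝ f n‖⁻¹ ≠ 0 := fun n =>
    inv_ne_zero (norm_ne_zero_iff.2 (hne n))
  refine ⟨fun n => ‖InnerProductSpace.gramSchmidt ℝ f n‖⁻¹ • InnerProductSpace.gramSchmidt ℝ f n,
    fun n => ?_, fun m n => ?_⟩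
  · rw [degree_smul_of_smul_regular _ (IsSMulRegular.of_ne_zero (hn n)), hgs]
  · rw [← hinner, real_inner_smul_left, real_inner_smul_right]
    by_cases hmn : m = n
    · subst hmn
      have := norm_ne_zero_iff.2 (hne m)
      rw [real_inner_self_eq_norm_sq, if_pos rfl]
      field_simp
    · rw [InnerProductSpace.gramSchmidt_orthogonal ℝ f hmn, if_neg hmn]
      simp

variable {K : Type*} [Field K] {Λ : K[X] →ₗ[K] K} {Q : ℕ → K[X]}

theorem Polynomial.eq_sum_of_orthonormal (hdeg : ∀ n, (Q n).degree = n)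
    (horth : ∀ m n, Λ (Q m * Q n) = if m = n then 1 else 0) {n : ℕ} {q : K[X]}
    (hq : q.degree < n) : q = ∑ k ∈ Finset.range n, Λ (q * Q k) • Q k := by
  let S : Polynomial.Sequence K := ⟨Q, hdeg⟩
  have hmem : q ∈ Submodule.span K (S '' Set.Iio n) := by
    rw [S.span_degreeLT fun i _ => (leadingCoeff_ne_zero.2 (S.ne_zero i)).isUnit]
    exact mem_degreeLT.2 hq
  clear hq
  induction hmem using Submodule.span_induction with
  | mem x hx =>
    obtain ⟨i, hi, rfl⟩ := hx
    change Q i = ∑ k ∈ Finset.range n, Λ (Q i * Q k) • Q k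
    simp_rw [horth, ite_smul, one_smul, zero_smul]
    rw [Finset.sum_ite_eq, if_pos (Finset.mem_range.2 hi)]
  | zero => simp
  | add x y hx hy ihx ihy =>
    simp_rw [add_mul, map_add, add_smul, Finset.sum_add_distrib]
    rw [← ihx, ← ihy]
  | smul a x hx ihx =>
    simp_rw [smul_mul_assoc, map_smul, smul_assoc, ← Finset.smul_sum]
    rw [← ihx]

theorem Polynomial.map_mul_eq_zero_of_orthonormal (hdeg : ∀ n, (Q n).degree = n)
    (horth : ∀ m n, Λ (Q m * Q n) = if m = n then 1 else 0) {n : ℕ} {q : K[X]}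
    (hq : q.degree < n) : Λ (Q n * q) = 0 := by
  rw [eq_sum_of_orthonormal hdeg horth hq, Finset.mul_sum, map_sum]
  refine Finset.sum_eq_zero fun k hk => ?_
  rw [mul_smul_comm, map_smul, horth, if_neg (Finset.mem_range.1 hk).ne', smul_zero]

theorem Polynomial.exists_eq_C_add_mul (p : K[X]) (z : K) :
    ∃ r, p = C (p.eval z) + (X - C z) * r := by
  obtain ⟨r, hr⟩ : X - C z ∣ p - C (p.eval z) := by
    rw [dvd_iff_isRoot]; simp
  exact ⟨r, by rw [← hr]; ring⟩

theorem Polynomial.degree_lt_of_eq_C_add_mul {p r : K[X]} {a z : K} {n : ℕ}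
    (hp : p.degree ≤ n) (h : p = C a + (X - C z) * r) : r.degree < n := by
  by_cases hr : r = 0
  · rw [hr, degree_zero]; exact WithBot.bot_lt_coe n
  have h1 : ((X - C z) * r).natDegree = 1 + r.natDegree := by
    rw [natDegree_mul (X_sub_C_ne_zero z) hr, natDegree_X_sub_C]
  have h2 : p.natDegree = 1 + r.natDegree := by rw [h, natDegree_C_add, h1]
  have h3 := natDegree_le_of_degree_le hp
  rw [degree_eq_natDegree hr]
  exact_mod_cast (by omega : r.natDegree < n)

/-- Dependence of orthonormal polynomials on the point, with a kernel of finite rank two. -/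
theorem Polynomial.eval_orthonormal_eq (hdeg : ∀ n, (Q n).degree = n)
    (horth : ∀ m n, Λ (Q m * Q n) = if m = n then 1 else 0) {z : K} {r : ℕ → K[X]}
    (hr : ∀ n, Q n = C ((Q n).eval z) + (X - C z) * r n) (w : K) (n : ℕ) :
    (Q n).eval w = (Q n).eval z + (w - z) * ∑ k ∈ Finset.range n,
      ((Q k).eval z * Λ (r n) - (Q n).eval z * Λ (r k)) * (Q k).eval w := by
  have hrdeg : ∀ n, (r n).degree < n := fun n =>
    degree_lt_of_eq_C_add_mul (hdeg n).le (hr n)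
  have hcoef : ∀ k < n, Λ (r n * Q k) = (Q k).eval z * Λ (r n) - (Q n).eval z * Λ (r k) := by
    intro k hk
    -- Both sides of the difference come from writing `(X - z) r_n r_k` in two ways; the middle term
    -- dies under `Λ` by orthogonality.
    have h1 : r n * Q k = (Q k).eval z • r n + Q n * r k - (Q n).eval z • r k := by
      rw [smul_eq_C_mul, smul_eq_C_mul]
      nth_rewrite 1 [hr k]
      have := hr n
      linear_combination (-r k) * this
    have h2 : Λ (Q n * r k) = 0 := map_mul_eq_zero_of_orthonormal hdeg horth
      ((hrdeg k).trans (by exact_mod_cast hk))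
    rw [h1, map_sub, map_add, map_smul, map_smul, h2, smul_eq_mul, smul_eq_mul, add_zero]
  have h3 := congrArg (eval w) (hr n)
  rw [eval_add, eval_C, eval_mul, eval_sub, eval_X, eval_C,
    eq_sum_of_orthonormal hdeg horth (hrdeg n), eval_finsetSum] at h3
  rw [h3]
  congr 2
  refine Finset.sum_congr rfl fun k hk => ?_
  rw [eval_smul, hcoef k (Finset.mem_range.1 hk), smul_eq_mul]

end OrthogonalPolynomials

/-- A discrete Grönwall inequality with a kernel of product form. -/
theorem le_mul_exp_of_le_mul_one_add_sum {v W : ℕ → ℝ} {c : ℝ} (hc : 0 ≤ c) (hW : ∀ n, 0 ≤ W n)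
    (h : ∀ n, v n ≤ W n * (1 + c * ∑ k ∈ Finset.range n, W k * v k)) (n : ℕ) :
    v n ≤ W n * Real.exp (c * ∑ k ∈ Finset.range n, W k ^ 2) := by
  -- Each step multiplies the bound by at most `1 + c W_n² ≤ exp (c W_n²)`.
  have hS : ∀ n, 1 + c * ∑ k ∈ Finset.range n, W k * v k
      ≤ Real.exp (c * ∑ k ∈ Finset.range n, W k ^ 2) := by
    intro n
    induction n with
    | zero => simp
    | succ n ih =>
      rw [Finset.sum_range_succ, Finset.sum_range_succ, mul_add, mul_add, Real.exp_add, ← add_assoc]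
      set S := c * ∑ k ∈ Finset.range n, W k * v k
      set E := Real.exp (c * ∑ k ∈ Finset.range n, W k ^ 2)
      have h1 : v n ≤ W n * E := (h n).trans (mul_le_mul_of_nonneg_left ih (hW n))
      have h2 : c * (W n * v n) ≤ c * (W n * (W n * E)) := by gcongr; exact hW n
      have h3 : c * W n ^ 2 + 1 ≤ Real.exp (c * W n ^ 2) := Real.add_one_le_exp _
      have h4 : E * (c * W n ^ 2 + 1) ≤ E * Real.exp (c * W n ^ 2) := by gcongr
      nlinarith
  exact (h n).trans (mul_le_mul_of_nonneg_left (hS n) (hW n))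

/-! ### Bessel inequalities for bounded functionals. -/

section Bessel

open Polynomial

variable {L : ℝ[X] →ₗ[ℝ] ℝ} {P : ℕ → ℝ[X]}

theorem Polynomial.map_sum_smul_mul_self (horth : ∀ m n, L (P m * P n) = if m = n then 1 else 0)
    (c : ℕ → ℝ) (N : ℕ) :
    L ((∑ n ∈ Finset.range N, c n • P n) * ∑ n ∈ Finset.range N, c n • P n)
      = ∑ n ∈ Finset.range N, c n ^ 2 := by
  rw [Finset.sum_mul, map_sum]
  refine Finset.sum_congr rfl fun n hn => ?_
  rw [Finset.mul_sum, map_sum, Finset.sum_eq_single_of_mem n hn fun m _ hm => ?_]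
  · rw [smul_mul_smul_comm, map_smul, horth, if_pos rfl, smul_eq_mul]; ring
  · rw [smul_mul_smul_comm, map_smul, horth, if_neg hm.symm, smul_zero]

/-- Testing on `∑ φ(P_n) P_n` gives `S² ≤ D S` for the partial sum `S`. -/
theorem Polynomial.sum_sq_le_of_sq_le (horth : ∀ m n, L (P m * P n) = if m = n then 1 else 0)
    (φ : ℝ[X] →ₗ[ℝ] ℝ) {D : ℝ} (hφ : ∀ p, φ p ^ 2 ≤ D * L (p * p)) (hD : 0 ≤ D) (N : ℕ) :
    ∑ n ∈ Finset.range N, φ (P n) ^ 2 ≤ D := by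
  have h := hφ (∑ n ∈ Finset.range N, φ (P n) • P n)
  rw [map_sum_smul_mul_self horth] at h
  have e : φ (∑ n ∈ Finset.range N, φ (P n) • P n) = ∑ n ∈ Finset.range N, φ (P n) ^ 2 := by
    rw [map_sum]
    exact Finset.sum_congr rfl fun n _ => by rw [map_smul, smul_eq_mul, sq]
  rw [e] at h
  rcases (Finset.sum_nonneg fun n _ => sq_nonneg (φ (P n)) :
    0 ≤ ∑ n ∈ Finset.range N, φ (P n) ^ 2).eq_or_lt with h0 | h0
  · rwa [← h0]
  · rw [sq] at h
    exact le_of_mul_le_mul_right h h0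

theorem Polynomial.sum_norm_sq_le_of_norm_sq_le
    (horth : ∀ m n, L (P m * P n) = if m = n then 1 else 0)
    (φ : ℝ[X] →ₗ[ℝ] ℂ) {D : ℝ} (hφ : ∀ p, ‖φ p‖ ^ 2 ≤ D * L (p * p)) (hD : 0 ≤ D) (N : ℕ) :
    ∑ n ∈ Finset.range N, ‖φ (P n)‖ ^ 2 ≤ 2 * D := by
  have e : ∀ z : ℂ, ‖z‖ ^ 2 = z.re ^ 2 + z.im ^ 2 := fun z => by
    rw [← Complex.normSq_eq_norm_sq, Complex.normSq_apply]; ring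
  have h1 := sum_sq_le_of_sq_le horth (Complex.reLm ∘ₗ φ) (D := D) (fun p => by
    have := hφ p
    rw [e] at this
    change (φ p).re ^ 2 ≤ _
    nlinarith [sq_nonneg (φ p).im]) hD N
  have h2 := sum_sq_le_of_sq_le horth (Complex.imLm ∘ₗ φ) (D := D) (fun p => by
    have := hφ p
    rw [e] at this
    change (φ p).im ^ 2 ≤ _
    nlinarith [sq_nonneg (φ p).re]) hD N
  simp_rw [e, Finset.sum_add_distrib]
  simp only [LinearMap.comp_apply, Complex.reLm_coe, Complex.imLm_coe] at h1 h2
  linarith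

end Bessel

/-! ### Indeterminacy bounds evaluation at every real point. -/

section PolynomialIntegral

open Polynomial

theorem integrable_eval {μ : Measure ℝ} (hμ : ∀ k : ℕ, Integrable (fun t : ℝ => t ^ k) μ)
    (p : ℝ[X]) : Integrable (fun t => p.eval t) μ := by
  simp_rw [eval_eq_sum_range]
  exact integrable_finsetSum _ fun k _ => (hμ k).const_mul _

theorem integrable_eval_ofReal {μ : Measure ℝ}
    (hμ : ∀ k : ℕ, Integrable (fun t : ℝ => t ^ k) μ) (q : ℂ[X]) :
    Integrable (fun t : ℝ => q.eval (t : ℂ)) μ := by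
  simp_rw [eval_eq_sum_range]
  refine integrable_finsetSum _ fun k _ => Integrable.const_mul ?_ _
  simpa using (hμ k).ofReal (𝕜 := ℂ)

/-- Integration of real polynomials against a measure with finite moments. -/
noncomputable def polynomialIntegral (μ : Measure ℝ)
    (hμ : ∀ k : ℕ, Integrable (fun t : ℝ => t ^ k) μ) : ℝ[X] →ₗ[ℝ] ℝ where
  toFun p := ∫ t, p.eval t ∂μ
  map_add' p q := by
    simp_rw [eval_add]
    exact integral_add (integrable_eval hμ p) (integrable_eval hμ q)
  map_smul' a p := by
    simp_rw [eval_smul, smul_eq_mul, integral_const_mul, RingHom.id_apply]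

/-- Integration of complex polynomials against a measure on the line with finite moments. -/
noncomputable def complexPolynomialIntegral (μ : Measure ℝ)
    (hμ : ∀ k : ℕ, Integrable (fun t : ℝ => t ^ k) μ) : ℂ[X] →ₗ[ℂ] ℂ where
  toFun q := ∫ t : ℝ, q.eval (t : ℂ) ∂μ
  map_add' p q := by
    simp_rw [eval_add]
    exact integral_add (integrable_eval_ofReal hμ p) (integrable_eval_ofReal hμ q)
  map_smul' a p := by
    simp_rw [eval_smul, smul_eq_mul, integral_const_mul, RingHom.id_apply]

theorem polynomialIntegral_apply {μ : Measure ℝ}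
    (hμ : ∀ k : ℕ, Integrable (fun t : ℝ => t ^ k) μ) (p : ℝ[X]) :
    polynomialIntegral μ hμ p = ∫ t, p.eval t ∂μ := rfl

theorem complexPolynomialIntegral_apply {μ : Measure ℝ}
    (hμ : ∀ k : ℕ, Integrable (fun t : ℝ => t ^ k) μ) (q : ℂ[X]) :
    complexPolynomialIntegral μ hμ q = ∫ t : ℝ, q.eval (t : ℂ) ∂μ := rfl

theorem eval_map_ofReal (p : ℝ[X]) (t : ℝ) :
    (p.map Complex.ofRealHom).eval (t : ℂ) = ((p.eval t : ℝ) : ℂ) :=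
  eval_map_apply Complex.ofRealHom t

theorem complexPolynomialIntegral_map {μ : Measure ℝ}
    (hμ : ∀ k : ℕ, Integrable (fun t : ℝ => t ^ k) μ) (p : ℝ[X]) :
    complexPolynomialIntegral μ hμ (p.map Complex.ofRealHom) = polynomialIntegral μ hμ p := by
  rw [complexPolynomialIntegral_apply, polynomialIntegral_apply]
  simp_rw [eval_map_ofReal]
  exact integral_complex_ofReal

theorem polynomialIntegral_eq_of_moments_eq {μ ν : Measure ℝ}
    (hμ : ∀ k : ℕ, Integrable (fun t : ℝ => t ^ k) μ)
    (hν : ∀ k : ℕ, Integrable (fun t : ℝ => t ^ k) ν)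
    (h : ∀ k : ℕ, ∫ t, t ^ k ∂μ = ∫ t, t ^ k ∂ν) :
    polynomialIntegral μ hμ = polynomialIntegral ν hν := by
  ext k
  simpa [polynomialIntegral_apply] using h k

theorem complexPolynomialIntegral_eq_of_moments_eq {μ ν : Measure ℝ}
    (hμ : ∀ k : ℕ, Integrable (fun t : ℝ => t ^ k) μ)
    (hν : ∀ k : ℕ, Integrable (fun t : ℝ => t ^ k) ν)
    (h : ∀ k : ℕ, ∫ t, t ^ k ∂μ = ∫ t, t ^ k ∂ν) :
    complexPolynomialIntegral μ hμ = complexPolynomialIntegral ν hν := by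
  ext k
  have e : ∀ t : ℝ, (t : ℂ) ^ k = ((t ^ k : ℝ) : ℂ) := fun t => by simp
  simp only [LinearMap.coe_comp, Function.comp_apply, complexPolynomialIntegral_apply,
    eval_monomial, one_mul, e]
  rw [integral_complex_ofReal, integral_complex_ofReal, h k]

/-- The variance of `|p|` is nonnegative. -/
theorem sq_integral_abs_eval_le {μ : Measure ℝ} [IsProbabilityMeasure μ]
    (hμ : ∀ k : ℕ, Integrable (fun t : ℝ => t ^ k) μ) (p : ℝ[X]) :
    (∫ t, |p.eval t| ∂μ) ^ 2 ≤ polynomialIntegral μ hμ (p * p) := by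
  set a := ∫ t, |p.eval t| ∂μ with ha
  have hi := (integrable_eval hμ p).abs
  have hi2 := integrable_eval hμ (p * p)
  have h0 : 0 ≤ ∫ t, ((p * p).eval t - 2 * a * |p.eval t| + a ^ 2) ∂μ := by
    refine integral_nonneg fun t => ?_
    have := sq_nonneg (|p.eval t| - a)
    have e := abs_mul_abs_self (p.eval t)
    simp only [eval_mul, Pi.zero_apply]
    nlinarith
  have hi3 := hi.const_mul (2 * a)
  rw [integral_add (f := fun t => (p * p).eval t - 2 * a * |p.eval t|) (hi2.sub hi3)
    (integrable_const _), integral_sub hi2 hi3, integral_const_mul, ← ha] at h0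
  simp only [integral_const, probReal_univ, one_smul] at h0
  rw [polynomialIntegral_apply]
  nlinarith

theorem integrable_eval_mul_inv {μ : Measure ℝ} [IsFiniteMeasure μ]
    (hμ : ∀ k : ℕ, Integrable (fun t : ℝ => t ^ k) μ) (q : ℂ[X]) {z : ℂ} (hz : 0 < z.im) :
    Integrable (fun t : ℝ => q.eval (t : ℂ) * ((t : ℂ) - z)⁻¹) μ :=
  (integrable_eval_ofReal hμ q).mul_bdd (c := z.im⁻¹) (by fun_prop)
    (Eventually.of_forall fun t => norm_inv_ofReal_sub_le t hz)

theorem norm_integral_eval_mul_inv_le {μ : Measure ℝ} [IsProbabilityMeasure μ]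
    (hμ : ∀ k : ℕ, Integrable (fun t : ℝ => t ^ k) μ) (p : ℝ[X]) {z : ℂ} (hz : 0 < z.im) :
    ‖∫ t : ℝ, (p.map Complex.ofRealHom).eval (t : ℂ) * ((t : ℂ) - z)⁻¹ ∂μ‖
      ≤ z.im⁻¹ * √(polynomialIntegral μ hμ (p * p)) := by
  have h1 : ‖∫ t : ℝ, (p.map Complex.ofRealHom).eval (t : ℂ) * ((t : ℂ) - z)⁻¹ ∂μ‖
      ≤ ∫ t, |p.eval t| * z.im⁻¹ ∂μ := by
    refine norm_integral_le_of_norm_le ((integrable_eval hμ p).abs.mul_const _)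
      (Eventually.of_forall fun t => ?_)
    rw [norm_mul, eval_map_ofReal, Complex.norm_real, Real.norm_eq_abs]
    gcongr
    exact norm_inv_ofReal_sub_le t hz
  rw [integral_mul_const, mul_comm] at h1
  refine h1.trans ?_
  gcongr
  exact Real.le_sqrt_of_sq_le (sq_integral_abs_eval_le hμ p)

theorem integral_eval_mul_inv {μ : Measure ℝ} [IsFiniteMeasure μ]
    (hμ : ∀ k : ℕ, Integrable (fun t : ℝ => t ^ k) μ) {q r : ℂ[X]} {a z : ℂ} (hz : 0 < z.im)
    (h : q = C a + (X - C z) * r) :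
    ∫ t : ℝ, q.eval (t : ℂ) * ((t : ℂ) - z)⁻¹ ∂μ
      = a * ∫ t : ℝ, ((t : ℂ) - z)⁻¹ ∂μ + complexPolynomialIntegral μ hμ r := by
  have e : ∀ t : ℝ, q.eval (t : ℂ) * ((t : ℂ) - z)⁻¹ = a * ((t : ℂ) - z)⁻¹ + r.eval (t : ℂ) := by
    intro t
    have hne : (t : ℂ) - z ≠ 0 := fun h0 => by
      have := congrArg Complex.im h0
      simp at this
      exact hz.ne' this
    rw [h, eval_add, eval_C, eval_mul, eval_sub, eval_X, eval_C]
    field_simp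
  simp_rw [e]
  rw [integral_add ((integrable_inv_ofReal_sub μ hz).const_mul a) (integrable_eval_ofReal hμ r),
    integral_const_mul, complexPolynomialIntegral_apply]

/-- If two measures with the same moments have different Stieltjes transforms at `z`, then
evaluation at `z` is bounded on polynomials in the `L²` norm. -/
theorem exists_norm_eval_sq_le {μ ν : Measure ℝ} [IsProbabilityMeasure μ] [IsProbabilityMeasure ν]
    (hμ : ∀ k : ℕ, Integrable (fun t : ℝ => t ^ k) μ)
    (hν : ∀ k : ℕ, Integrable (fun t : ℝ => t ^ k) ν)
    (h : ∀ k : ℕ, ∫ t, t ^ k ∂μ = ∫ t, t ^ k ∂ν) {z : ℂ} (hz : 0 < z.im)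
    (hne : ∫ t : ℝ, ((t : ℂ) - z)⁻¹ ∂μ ≠ ∫ t : ℝ, ((t : ℂ) - z)⁻¹ ∂ν) :
    ∃ D, 0 ≤ D ∧ ∀ p : ℝ[X],
      ‖(p.map Complex.ofRealHom).eval z‖ ^ 2 ≤ D * polynomialIntegral μ hμ (p * p) := by
  set F := ∫ t : ℝ, ((t : ℂ) - z)⁻¹ ∂μ - ∫ t : ℝ, ((t : ℂ) - z)⁻¹ ∂ν with hF
  have hF0 : 0 < ‖F‖ := norm_pos_iff.2 (sub_ne_zero.2 hne)
  refine ⟨(2 * z.im⁻¹ / ‖F‖) ^ 2, sq_nonneg _, fun p => ?_⟩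
  obtain ⟨r, hr⟩ := exists_eq_C_add_mul (p.map Complex.ofRealHom) z
  have e1 := integral_eval_mul_inv hμ hz hr
  have e2 := integral_eval_mul_inv hν hz hr
  have b1 := norm_integral_eval_mul_inv_le hμ p hz
  have b2 := norm_integral_eval_mul_inv_le hν p hz
  rw [← polynomialIntegral_eq_of_moments_eq hμ hν h] at b2
  rw [← complexPolynomialIntegral_eq_of_moments_eq hμ hν h] at e2
  have hL : 0 ≤ polynomialIntegral μ hμ (p * p) :=
    (sq_nonneg _).trans (sq_integral_abs_eval_le hμ p)
  -- The difference quotient `r` is a polynomial, so its integrals against `μ` and `ν` agree and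
  -- cancel.
  have e3 : (p.map Complex.ofRealHom).eval z * F
      = (∫ t : ℝ, (p.map Complex.ofRealHom).eval (t : ℂ) * ((t : ℂ) - z)⁻¹ ∂μ)
        - ∫ t : ℝ, (p.map Complex.ofRealHom).eval (t : ℂ) * ((t : ℂ) - z)⁻¹ ∂ν := by
    rw [e1, e2, hF]; ring
  have b3 : ‖(p.map Complex.ofRealHom).eval z‖ * ‖F‖
      ≤ 2 * z.im⁻¹ * √(polynomialIntegral μ hμ (p * p)) := by
    rw [← norm_mul, e3]
    refine (norm_sub_le _ _).trans ?_
    linarith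
  rw [← le_div_iff₀ hF0] at b3
  refine (pow_le_pow_left₀ (norm_nonneg _) b3 2).trans_eq ?_
  rw [mul_div_right_comm, mul_pow, Real.sq_sqrt hL]

/-- The difference quotient functional `p ↦ ∫ (p(t) - p(z)) / (t - z) dμ(t)`. -/
noncomputable def quotientIntegral (μ : Measure ℝ) [IsFiniteMeasure μ]
    (hμ : ∀ k : ℕ, Integrable (fun t : ℝ => t ^ k) μ) {z : ℂ} (hz : 0 < z.im) : ℝ[X] →ₗ[ℝ] ℂ where
  toFun p := (∫ t : ℝ, (p.map Complex.ofRealHom).eval (t : ℂ) * ((t : ℂ) - z)⁻¹ ∂μ)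
    - (p.map Complex.ofRealHom).eval z * ∫ t : ℝ, ((t : ℂ) - z)⁻¹ ∂μ
  map_add' p q := by
    simp_rw [Polynomial.map_add, eval_add, add_mul]
    rw [integral_add (integrable_eval_mul_inv hμ _ hz) (integrable_eval_mul_inv hμ _ hz)]
    ring
  map_smul' a p := by
    simp_rw [Polynomial.map_smul, eval_smul, smul_eq_mul, mul_assoc, integral_const_mul]
    simp [mul_sub]

theorem quotientIntegral_eq {μ : Measure ℝ} [IsFiniteMeasure μ]
    (hμ : ∀ k : ℕ, Integrable (fun t : ℝ => t ^ k) μ) {z : ℂ} (hz : 0 < z.im) {p : ℝ[X]} {r : ℂ[X]}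
    (h : p.map Complex.ofRealHom = C ((p.map Complex.ofRealHom).eval z) + (X - C z) * r) :
    quotientIntegral μ hμ hz p = complexPolynomialIntegral μ hμ r := by
  change (∫ t : ℝ, (p.map Complex.ofRealHom).eval (t : ℂ) * ((t : ℂ) - z)⁻¹ ∂μ)
    - (p.map Complex.ofRealHom).eval z * ∫ t : ℝ, ((t : ℂ) - z)⁻¹ ∂μ = _
  rw [integral_eval_mul_inv hμ hz h]
  ring

/-- Both terms defining the functional are controlled by the `L²` norm, the second through the bound
at `z`. On orthonormal polynomials its values are the second-kind polynomials at `z`, which Bessel's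
inequality then makes square summable. -/
theorem norm_quotientIntegral_sq_le {μ : Measure ℝ} [IsProbabilityMeasure μ]
    (hμ : ∀ k : ℕ, Integrable (fun t : ℝ => t ^ k) μ) {z : ℂ} (hz : 0 < z.im) {D : ℝ} (p : ℝ[X])
    (hD : ‖(p.map Complex.ofRealHom).eval z‖ ^ 2 ≤ D * polynomialIntegral μ hμ (p * p)) :
    ‖quotientIntegral μ hμ hz p‖ ^ 2
      ≤ (2 * z.im⁻¹ ^ 2 * (1 + D)) * polynomialIntegral μ hμ (p * p) := by
  have hL : 0 ≤ polynomialIntegral μ hμ (p * p) :=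
    (sq_nonneg _).trans (sq_integral_abs_eval_le hμ p)
  have b1 := norm_integral_eval_mul_inv_le hμ p hz
  have b2 : ‖∫ t : ℝ, ((t : ℂ) - z)⁻¹ ∂μ‖ ≤ z.im⁻¹ := by
    simpa using norm_integral_le_of_norm_le_const (μ := μ)
      (Eventually.of_forall fun t => norm_inv_ofReal_sub_le t hz)
  have b3 : ‖quotientIntegral μ hμ hz p‖ ≤ z.im⁻¹ *
      (√(polynomialIntegral μ hμ (p * p)) + ‖(p.map Complex.ofRealHom).eval z‖) := by
    refine (norm_sub_le _ _).trans ?_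
    rw [norm_mul, mul_add]
    refine add_le_add b1 ?_
    rw [mul_comm]
    gcongr
  refine (pow_le_pow_left₀ (norm_nonneg _) b3 2).trans ?_
  rw [mul_pow, mul_comm 2, mul_assoc, mul_assoc]
  gcongr
  have := Real.sq_sqrt hL
  nlinarith [sq_nonneg (√(polynomialIntegral μ hμ (p * p)) - ‖(p.map Complex.ofRealHom).eval z‖)]

/-- Growth of orthonormal polynomials away from a point `z` at which they and the associated
polynomials are square summable. -/
theorem norm_eval_orthonormal_le {Λ : ℂ[X] →ₗ[ℂ] ℂ} {Q r : ℕ → ℂ[X]} {z : ℂ} {E : ℝ}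
    (hdeg : ∀ n, (Q n).degree = n)
    (horth : ∀ m n, Λ (Q m * Q n) = if m = n then 1 else 0)
    (hr : ∀ n, Q n = C ((Q n).eval z) + (X - C z) * r n)
    (hE : ∀ N, ∑ n ∈ Finset.range N, (‖(Q n).eval z‖ + ‖Λ (r n)‖) ^ 2 ≤ E) (w : ℂ) (n : ℕ) :
    ‖(Q n).eval w‖ ≤ (‖(Q n).eval z‖ + ‖Λ (r n)‖) * Real.exp (‖w - z‖ * E) := by
  have hW0 : ∀ n, 0 ≤ ‖(Q n).eval z‖ + ‖Λ (r n)‖ := fun n => by positivity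
  have hrec : ∀ n, ‖(Q n).eval w‖ ≤ (‖(Q n).eval z‖ + ‖Λ (r n)‖) * (1 + ‖w - z‖ *
      ∑ k ∈ Finset.range n, (‖(Q k).eval z‖ + ‖Λ (r k)‖) * ‖(Q k).eval w‖) := by
    intro n
    rw [eval_orthonormal_eq hdeg horth hr w n]
    refine (norm_add_le _ _).trans ?_
    rw [norm_mul, mul_add, mul_one, mul_left_comm, Finset.mul_sum]
    refine add_le_add (le_add_of_nonneg_right (norm_nonneg _)) ?_
    refine mul_le_mul_of_nonneg_left ((norm_sum_le _ _).trans (Finset.sum_le_sum fun k _ => ?_))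
      (norm_nonneg _)
    rw [norm_mul, ← mul_assoc]
    refine mul_le_mul_of_nonneg_right ((norm_sub_le _ _).trans ?_) (norm_nonneg _)
    rw [norm_mul, norm_mul]
    have := mul_nonneg (norm_nonneg ((Q n).eval z)) (norm_nonneg ((Q k).eval z))
    have := mul_nonneg (norm_nonneg (Λ (r n))) (norm_nonneg (Λ (r k)))
    linarith
  refine (le_mul_exp_of_le_mul_one_add_sum (norm_nonneg _) hW0 hrec n).trans ?_
  exact mul_le_mul_of_nonneg_left
    (Real.exp_le_exp.2 (mul_le_mul_of_nonneg_left (hE n) (norm_nonneg _))) (hW0 n)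

/-- Cauchy–Schwarz in the orthonormal expansion of `p`, with Parseval for `L (p * p)`. -/
theorem eval_sq_le_of_sum_sq_le {L : ℝ[X] →ₗ[ℝ] ℝ} {P : ℕ → ℝ[X]} {x E : ℝ}
    (hdeg : ∀ n, (P n).degree = n) (horth : ∀ m n, L (P m * P n) = if m = n then 1 else 0)
    (hE : ∀ N, ∑ n ∈ Finset.range N, (P n).eval x ^ 2 ≤ E) (p : ℝ[X]) :
    p.eval x ^ 2 ≤ E * L (p * p) := by
  obtain ⟨N, hN⟩ : ∃ N : ℕ, p.degree < N :=
    ⟨p.natDegree + 1, (degree_le_natDegree).trans_lt (by exact_mod_cast Nat.lt_succ_self _)⟩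
  have hp := eq_sum_of_orthonormal hdeg horth hN
  have hpp := map_sum_smul_mul_self horth (fun k => L (p * P k)) N
  rw [← hp] at hpp
  have hpx := congrArg (eval x) hp
  simp_rw [eval_finsetSum, eval_smul, smul_eq_mul] at hpx
  rw [hpx, hpp, mul_comm E]
  exact (Finset.sum_mul_sq_le_sq_mul_sq _ _ _).trans
    (mul_le_mul_of_nonneg_left (hE N) (Finset.sum_nonneg fun _ _ => sq_nonneg _))

/-- If a measure with finite moments is not determined by its moments, then evaluation at any real
point is bounded on polynomials in the `L²` norm. -/
theorem exists_eval_sq_le_of_ne {μ ν : Measure ℝ} [IsProbabilityMeasure μ]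
    [IsProbabilityMeasure ν]
    (hμ : ∀ k : ℕ, Integrable (fun t : ℝ => t ^ k) μ)
    (hν : ∀ k : ℕ, Integrable (fun t : ℝ => t ^ k) ν)
    (h : ∀ k : ℕ, ∫ t, t ^ k ∂μ = ∫ t, t ^ k ∂ν)
    (hpos : ∀ p : ℝ[X], p ≠ 0 → 0 < polynomialIntegral μ hμ (p * p)) (hne : μ ≠ ν) (x : ℝ) :
    ∃ D, 0 ≤ D ∧ ∀ p : ℝ[X], p.eval x ^ 2 ≤ D * polynomialIntegral μ hμ (p * p) := by
  obtain ⟨z, hz, hzne⟩ : ∃ z : ℂ, 0 < z.im ∧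
      ∫ t : ℝ, ((t : ℂ) - z)⁻¹ ∂μ ≠ ∫ t : ℝ, ((t : ℂ) - z)⁻¹ ∂ν := by
    by_contra! hcon
    exact hne (MeasureTheory.Measure.ext_of_stieltjes hcon)
  obtain ⟨D, hD0, hD⟩ := exists_norm_eval_sq_le hμ hν h hz hzne
  obtain ⟨P, hPdeg, hPorth⟩ := exists_orthonormal _ hpos
  let Q : ℕ → ℂ[X] := fun n => (P n).map Complex.ofRealHom
  have hQdeg : ∀ n, (Q n).degree = n := fun n => by rw [degree_map, hPdeg]
  have hQorth : ∀ m n, complexPolynomialIntegral μ hμ (Q m * Q n) = if m = n then 1 else 0 := by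
    intro m n
    rw [← Polynomial.map_mul, complexPolynomialIntegral_map, hPorth]
    split_ifs <;> simp
  choose r hr using fun n => exists_eq_C_add_mul (Q n) z
  have hs : ∀ n, quotientIntegral μ hμ hz (P n) = complexPolynomialIntegral μ hμ (r n) :=
    fun n => quotientIntegral_eq hμ hz (hr n)
  let evalz : ℝ[X] →ₗ[ℝ] ℂ := (aeval (R := ℝ) z).toLinearMap
  have hevalz : ∀ p : ℝ[X], evalz p = (p.map Complex.ofRealHom).eval z := fun p =>
    (eval_map_algebraMap p z).symm
  have hA := sum_norm_sq_le_of_norm_sq_le hPorth evalz (fun p => by rw [hevalz]; exact hD p) hD0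
  have hB := sum_norm_sq_le_of_norm_sq_le hPorth (quotientIntegral μ hμ hz)
    (fun p => norm_quotientIntegral_sq_le hμ hz p (hD p)) (by positivity)
  obtain ⟨E, hE⟩ : ∃ E, ∀ N, ∑ n ∈ Finset.range N,
      (‖(Q n).eval z‖ + ‖complexPolynomialIntegral μ hμ (r n)‖) ^ 2 ≤ E := by
    -- From `(a + b)² ≤ 2 (a² + b²)` and the two Bessel bounds, each doubled for real and imaginary
    -- parts.
    refine ⟨2 * (2 * D) + 2 * (2 * (2 * z.im⁻¹ ^ 2 * (1 + D))), fun N => ?_⟩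
    refine (Finset.sum_le_sum fun n _ => add_sq_le).trans ?_
    rw [← Finset.mul_sum, Finset.sum_add_distrib]
    have hA' := hA N
    have hB' := hB N
    simp_rw [hs] at hB'
    simp_rw [hevalz] at hA'
    linarith
  have hE0 : 0 ≤ E := by simpa using hE 0
  have hbd := norm_eval_orthonormal_le hQdeg hQorth hr hE (x : ℂ)
  refine ⟨E * Real.exp (‖(x : ℂ) - z‖ * E) ^ 2, by positivity,
    eval_sq_le_of_sum_sq_le hPdeg hPorth fun N => ?_⟩
  refine le_trans (Finset.sum_le_sum fun n _ => ?_)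
    ((Finset.sum_mul _ _ _).symm.le.trans
      (mul_le_mul_of_nonneg_right (hE N) (sq_nonneg (Real.exp (‖(x : ℂ) - z‖ * E)))))
  rw [← mul_pow, ← sq_abs, ← Real.norm_eq_abs, ← Complex.norm_real, ← eval_map_ofReal]
  exact pow_le_pow_left₀ (norm_nonneg _) (hbd n) 2

end PolynomialIntegral

/-! ### Hankel determinants and the extremal problem at `0`. -/

section Hankel

open Polynomial

variable {L : ℝ[X] →ₗ[ℝ] ℝ}

theorem hankel_mulVec (m s i : ℕ) (c : Fin m → ℝ) :
    ∑ j : Fin m, L (X ^ ((i + s) + ((j : ℕ) + s))) * c j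
      = L (X ^ (i + s) * (X ^ s * ∑ j : Fin m, c j • X ^ (j : ℕ))) := by
  rw [Finset.mul_sum, Finset.mul_sum, map_sum]
  refine Finset.sum_congr rfl fun j _ => ?_
  rw [mul_smul_comm, mul_smul_comm, map_smul, smul_eq_mul, mul_comm, ← pow_add, ← pow_add,
    add_comm s]

theorem hankel_dotProduct (m s : ℕ) (c : Fin m → ℝ) :
    c ⬝ᵥ (Matrix.of fun i j : Fin m => L (X ^ (((i : ℕ) + s) + ((j : ℕ) + s)))).mulVec c
      = L ((X ^ s * ∑ j : Fin m, c j • X ^ (j : ℕ)) * (X ^ s * ∑ j : Fin m, c j • X ^ (j : ℕ))) := by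
  have e : ∀ i : Fin m, (Matrix.of fun i j : Fin m =>
      L (X ^ (((i : ℕ) + s) + ((j : ℕ) + s)))).mulVec c i
      = L (X ^ ((i : ℕ) + s) * (X ^ s * ∑ j : Fin m, c j • X ^ (j : ℕ))) := fun i =>
    hankel_mulVec m s i c
  simp_rw [dotProduct, e]
  nth_rewrite 2 [Finset.mul_sum]
  rw [Finset.sum_mul, map_sum]
  refine Finset.sum_congr rfl fun j _ => ?_
  rw [mul_smul_comm, smul_mul_assoc, map_smul, smul_eq_mul, ← pow_add, add_comm s]

theorem coeff_sum_smul_X_pow {m : ℕ} (c : Fin m → ℝ) (i : Fin m) :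
    (∑ j : Fin m, c j • (X : ℝ[X]) ^ (j : ℕ)).coeff i = c i := by
  simp [coeff_X_pow, Fin.val_inj]

/-- The quadratic form at `c` is `L` of the square of `X ^ s * ∑ c_j X ^ j`. The shift `s = 0`
serves `H_n` and `s = 1` serves `G_n`. -/
theorem hankel_det_pos (hL : ∀ p, p ≠ 0 → 0 < L (p * p)) (m s : ℕ) :
    0 < (Matrix.of fun i j : Fin m => L (X ^ (((i : ℕ) + s) + ((j : ℕ) + s)))).det := by
  refine Matrix.PosDef.det_pos (Matrix.PosDef.of_dotProduct_mulVec_pos ?_ fun c hc => ?_)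
  · ext i j
    simp [add_comm]
  · rw [star_trivial, hankel_dotProduct]
    refine hL _ (mul_ne_zero (pow_ne_zero _ X_ne_zero) fun h0 => hc ?_)
    ext i
    rw [← coeff_sum_smul_X_pow c i, h0]
    simp

theorem hankelG_pos (hL : ∀ p, p ≠ 0 → 0 < L (p * p)) (n : ℕ) :
    0 < hankelG (fun k => L (X ^ k)) n :=
  hankel_det_pos hL n 1

theorem hankelH_pos (hL : ∀ p, p ≠ 0 → 0 < L (p * p)) (n : ℕ) :
    0 < hankelH (fun k => L (X ^ k)) n :=
  hankel_det_pos hL (n + 1) 0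

/-- The polynomial of degree at most `n` that represents evaluation at `0`; its value at `0` is a
quotient of Hankel determinants. -/
theorem exists_reproducing (hL : ∀ p, p ≠ 0 → 0 < L (p * p)) (n : ℕ) :
    ∃ p : ℝ[X], p.degree < (n + 1 : ℕ) ∧
      (∀ q : ℝ[X], q.degree < (n + 1 : ℕ) → L (p * q) = q.eval 0) ∧
      p.eval 0 = hankelG (fun k => L (X ^ k)) n / hankelH (fun k => L (X ^ k)) n := by
  have hH := hankelH_pos hL n
  rw [hankelH] at hH ⊢
  set A := Matrix.of fun i j : Fin (n + 1) => L (X ^ ((i : ℕ) + (j : ℕ))) with hA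
  have hdet : IsUnit A.det := hH.ne'.isUnit
  let c : Fin (n + 1) → ℝ := A⁻¹.mulVec (Pi.single 0 1)
  have hc : A.mulVec c = Pi.single 0 1 := by
    rw [Matrix.mulVec_mulVec, Matrix.mul_nonsing_inv A hdet, Matrix.one_mulVec]
  have hLc : ∀ i : Fin (n + 1), L ((∑ j, c j • X ^ (j : ℕ)) * X ^ (i : ℕ))
      = (Pi.single 0 1 : Fin (n + 1) → ℝ) i := by
    intro i
    rw [← hc]
    have := hankel_mulVec (L := L) (n + 1) 0 i c
    simp only [add_zero, pow_zero, one_mul] at this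
    rw [mul_comm, ← this]
    rfl
  refine ⟨∑ j, c j • X ^ (j : ℕ), ?_, fun q hq => ?_, ?_⟩
  · refine mem_degreeLT.1 (Submodule.sum_mem (degreeLT ℝ (n + 1)) fun j _ =>
      Submodule.smul_mem _ _ ?_)
    rw [mem_degreeLT, degree_X_pow]
    exact_mod_cast j.2
  · have hq' : q = ∑ i : Fin (n + 1), q.coeff i • X ^ (i : ℕ) := by
      rw [Fin.sum_univ_eq_sum_range (fun i => q.coeff i • (X : ℝ[X]) ^ i) (n + 1)]
      simp_rw [smul_eq_C_mul]
      refine as_sum_range_C_mul_X_pow' q ?_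
      by_cases hq0 : q = 0
      · simp [hq0]
      · exact (natDegree_lt_iff_degree_lt hq0).2 hq
    nth_rewrite 1 [hq']
    rw [Finset.mul_sum, map_sum, ← coeff_zero_eq_eval_zero]
    simp_rw [mul_smul_comm, map_smul, hLc, smul_eq_mul]
    rw [Finset.sum_eq_single_of_mem 0 (Finset.mem_univ _) fun i _ hi => by simp [hi]]
    simp
  · rw [← coeff_zero_eq_eval_zero]
    have h0 := coeff_sum_smul_X_pow c 0
    rw [Fin.val_zero] at h0
    rw [h0]
    change A⁻¹.mulVec (Pi.single 0 1) 0 = _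
    -- The constant coefficient is the `(0, 0)` entry of `A⁻¹`; deleting row and column `0` leaves
    -- the matrix of `G_n`.
    rw [Matrix.mulVec_single_one, Matrix.col_apply, Matrix.inv_def, Matrix.smul_apply,
      Matrix.adjugate_fin_succ_eq_det_submatrix, Ring.inverse_eq_inv', smul_eq_mul, div_eq_inv_mul,
      hankelG]
    simp [hA, Matrix.submatrix]

/-- `H_n / G_n → 0` exactly when evaluation at `0` is unbounded on polynomials. -/
theorem tendsto_hankel_div_iff (hL : ∀ p, p ≠ 0 → 0 < L (p * p)) :
    Tendsto (fun n => hankelH (fun k => L (X ^ k)) n / hankelG (fun k => L (X ^ k)) n) atTop (𝓝 0)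
      ↔ ¬ ∃ ε > 0, ∀ p : ℝ[X], ε * p.eval 0 ^ 2 ≤ L (p * p) := by
  have hpos : ∀ n, 0 < hankelH (fun k => L (X ^ k)) n / hankelG (fun k => L (X ^ k)) n :=
    fun n => div_pos (hankelH_pos hL n) (hankelG_pos hL n)
  constructor
  · rintro h ⟨ε, hε, hle⟩
    obtain ⟨n, hn⟩ := (h.eventually (gt_mem_nhds hε)).exists
    obtain ⟨p, hpd, hrep, hp0⟩ := exists_reproducing hL n
    have h1 := hle p
    rw [hrep p hpd] at h1
    have h2 : 0 < p.eval 0 := by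
      rw [hp0, ← inv_div]
      exact inv_pos.2 (hpos n)
    have h3 : ε * p.eval 0 ≤ 1 := le_of_mul_le_mul_right (by linarith) h2
    rw [← inv_div, ← hp0, inv_lt_iff_one_lt_mul₀ h2] at hn
    linarith
  · intro h
    by_contra hnot
    refine h ?_
    rw [tendsto_order] at hnot
    have h1 : ¬ ∀ ε > 0, ∀ᶠ n in atTop,
        hankelH (fun k => L (X ^ k)) n / hankelG (fun k => L (X ^ k)) n < ε := fun h1 =>
      hnot ⟨fun a ha => Eventually.of_forall fun n => ha.trans (hpos n), fun a ha => h1 a ha⟩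
    push Not at h1
    obtain ⟨ε, hε, hfreq⟩ := h1
    refine ⟨ε, hε, fun q => ?_⟩
    -- A lower bound along infinitely many `n` suffices, since one of them exceeds the degree of
    -- `q`.
    obtain ⟨n, hn, hqn⟩ := (hfreq.and_eventually (eventually_ge_atTop q.natDegree)).exists
    have hqd : q.degree < (n + 1 : ℕ) :=
      degree_le_natDegree.trans_lt (by exact_mod_cast Nat.lt_succ_of_le hqn)
    obtain ⟨p, hpd, hrep, hp0⟩ := exists_reproducing hL n
    rw [← inv_div] at hp0
    set ρ := hankelH (fun k => L (X ^ k)) n / hankelG (fun k => L (X ^ k)) n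
    have hρ : ρ ≠ 0 := (hpos n).ne'
    -- Subtracting the projection of `q` onto the reproducing polynomial `p` (with `L (p * p) = p(0)
    -- = ρ⁻¹`) yields `ρ q(0)² ≤ L (q * q)`.
    have h2 : 0 ≤ L ((q - (q.eval 0 * ρ) • p) * (q - (q.eval 0 * ρ) • p)) := by
      by_cases h0 : q - (q.eval 0 * ρ) • p = 0
      · simp [h0]
      · exact (hL _ h0).le
    have e : (q - (q.eval 0 * ρ) • p) * (q - (q.eval 0 * ρ) • p)
        = q * q - (2 * (q.eval 0 * ρ)) • (p * q) + ((q.eval 0 * ρ) ^ 2) • (p * p) := by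
      simp only [smul_eq_C_mul, C_mul, C_pow, C_ofNat]
      ring
    rw [e, map_add, map_sub, map_smul, map_smul, hrep q hqd, hrep p hpd, hp0, smul_eq_mul,
      smul_eq_mul] at h2
    have e2 : (q.eval 0 * ρ) ^ 2 * ρ⁻¹ = ρ * q.eval 0 ^ 2 := by field_simp
    rw [e2] at h2
    nlinarith [mul_le_mul_of_nonneg_right hn (sq_nonneg (q.eval 0))]

end Hankel

/-! ### Determinacy and boundedness of evaluation. -/

section Determinacy

open Polynomial

variable {μ : Measure ℝ}

/-- If evaluation at `x` is bounded on polynomials in `L²(μ)` and `x` is not an atom of `μ`, then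
`μ` is not determined by its moments. -/
theorem not_isHamburgerDeterminate_of_eval_sq_le
    (hμ : ∀ k : ℕ, Integrable (fun t : ℝ => t ^ k) μ) {x ε : ℝ} (hx : μ {x} = 0) (hε : 0 < ε)
    (h : ∀ p : ℝ[X], ε * p.eval x ^ 2 ≤ polynomialIntegral μ hμ (p * p)) :
    ¬ IsHamburgerDeterminate μ := by
  intro hdet
  obtain ⟨ν, hν⟩ := exists_measure_of_nonneg_on_squares
    (polynomialIntegral μ hμ - ε • (aeval (R := ℝ) x).toLinearMap) (fun q => by
      have := h q
      simp
      linarith)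
  have hfin : ∀ k : ℕ, Integrable (fun t : ℝ => t ^ k) (ENNReal.ofReal ε • Measure.dirac x) :=
    fun k => (integrable_dirac (by simp)).smul_measure ENNReal.ofReal_ne_top
  have hsol : IsHamburgerSolution (measureMoment μ) (ν + ENNReal.ofReal ε • Measure.dirac x) := by
    intro k
    refine ⟨(hν k).1.add_measure (hfin k), ?_⟩
    rw [measureMoment, integral_add_measure (hν k).1 (hfin k), (hν k).2, integral_smul_measure,
      integral_dirac]
    simp [polynomialIntegral_apply, measureMoment, ENNReal.toReal_ofReal hε.le]
  -- Uniqueness would force `μ` to carry mass at least `ε` at `x`.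
  have heq := hdet.unique hsol fun k => ⟨hμ k, rfl⟩
  rw [← heq] at hx
  simp at hx
  linarith [hx.2]

theorem isHamburgerDeterminate_of_not_eval_sq_le [IsProbabilityMeasure μ]
    (hμ : ∀ k : ℕ, Integrable (fun t : ℝ => t ^ k) μ)
    (hpos : ∀ p : ℝ[X], p ≠ 0 → 0 < polynomialIntegral μ hμ (p * p)) {x : ℝ}
    (h : ¬ ∃ ε > 0, ∀ p : ℝ[X], ε * p.eval x ^ 2 ≤ polynomialIntegral μ hμ (p * p)) :
    IsHamburgerDeterminate μ := by
  refine ⟨μ, fun k => ⟨hμ k, rfl⟩, fun ν hν => ?_⟩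
  by_contra hne
  refine h ?_
  have hνint : ∀ k : ℕ, Integrable (fun t : ℝ => t ^ k) ν := fun k => (hν k).1
  have hmom : ∀ k : ℕ, ∫ t, t ^ k ∂μ = ∫ t, t ^ k ∂ν := fun k => (hν k).2.symm
  have : IsProbabilityMeasure ν := by
    have h1 : IsFiniteMeasure ν := by
      have := hνint 0
      simp only [pow_zero] at this
      exact (integrable_const_iff_isFiniteMeasure one_ne_zero).1 this
    have h2 := hmom 0
    simp only [pow_zero, integral_const, probReal_univ, smul_eq_mul, mul_one] at h2
    exact ⟨by rw [← ENNReal.toReal_eq_one_iff]; exact h2.symm⟩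
  obtain ⟨D, hD0, hD⟩ := exists_eval_sq_le_of_ne hμ hνint hmom hpos (Ne.symm hne) x
  refine ⟨(D + 1)⁻¹, by positivity, fun p => ?_⟩
  rw [inv_mul_le_iff₀ (by positivity)]
  have h3 : 0 ≤ polynomialIntegral μ hμ (p * p) :=
    (sq_nonneg _).trans (sq_integral_abs_eval_le hμ p)
  linarith [hD p]

/-- Squares of nonzero polynomials have positive integral against a measure of infinite support. -/
theorem integral_sq_pos_of_infinite_support {α : Measure ℝ} (hα : α.support.Infinite)
    {p : ℝ[X]} (hp : p ≠ 0) (hi : Integrable (fun t => p.eval t * p.eval t) α) :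
    0 < ∫ t, p.eval t * p.eval t ∂α := by
  refine lt_of_le_of_ne (integral_nonneg fun t => mul_self_nonneg _) fun h0 => hα ?_
  have h1 := (integral_eq_zero_iff_of_nonneg (fun t => mul_self_nonneg (p.eval t)) hi).1 h0.symm
  refine (p.roots.toFinset.finite_toSet).subset
    (Measure.support_subset_of_isClosed (p.roots.toFinset.finite_toSet.isClosed) ?_)
  filter_upwards [h1] with t ht
  simpa [hp] using ht

end Determinacy

/-! ### The theorem for the push-forward under squaring. -/

theorem mainTheorem3 (α : Measure ℝ) [IsProbabilityMeasure α]
    (hsymm : α.IsNegInvariant)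
    (hmom : ∀ k : ℕ, Integrable (fun t : ℝ => t ^ k) α)
    (hsupp : α.support.Infinite)
    (hzero : α {0} = 0) :
    (∀ n : ℕ, hankelG (measureMoment (squarePushforward α)) n ≠ 0) ∧
      (IsHamburgerDeterminate (squarePushforward α) ↔
        Tendsto
          (fun n : ℕ => hankelH (measureMoment (squarePushforward α)) n /
            hankelG (measureMoment (squarePushforward α)) n)
          atTop (𝓝 0)) := by
  have hsq : Measurable (fun t : ℝ => t ^ 2) := by fun_prop
  have hμ : ∀ k : ℕ, Integrable (fun t : ℝ => t ^ k) (squarePushforward α) := fun k => by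
    rw [squarePushforward, integrable_map_measure (by fun_prop) hsq.aemeasurable]
    exact (hmom (2 * k)).congr (Eventually.of_forall fun t => by simp [pow_mul])
  have : IsProbabilityMeasure (squarePushforward α) :=
    Measure.isProbabilityMeasure_map hsq.aemeasurable
  have hx : squarePushforward α {0} = 0 := by
    rw [squarePushforward, Measure.map_apply hsq (measurableSet_singleton 0)]
    have e : (fun t : ℝ => t ^ 2) ⁻¹' {0} = {0} := by ext t; simp
    rw [e, hzero]
  have hpos : ∀ p : Polynomial ℝ, p ≠ 0 → 0 < polynomialIntegral (squarePushforward α) hμ (p * p) := by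
    intro p hp
    rw [polynomialIntegral_apply, squarePushforward,
      integral_map hsq.aemeasurable (p * p).continuous.aestronglyMeasurable]
    -- Positivity is pulled back to `α` through `p(t²)`, so the infinite support of `α` is used
    -- directly.
    have hq : Polynomial.expand ℝ 2 p ≠ 0 := by rwa [Ne, Polynomial.expand_eq_zero two_pos]
    have := integral_sq_pos_of_infinite_support hsupp hq
      (by simpa using integrable_eval hmom (Polynomial.expand ℝ 2 p * Polynomial.expand ℝ 2 p))
    simpa [Polynomial.expand_eval] using this
  have hb : measureMoment (squarePushforward α)
      = fun k => polynomialIntegral (squarePushforward α) hμ (Polynomial.X ^ k) := by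
    ext k
    simp [measureMoment, polynomialIntegral_apply]
  rw [hb]
  refine ⟨fun n => (hankelG_pos hpos n).ne', ?_⟩
  rw [tendsto_hankel_div_iff hpos]
  refine ⟨fun hdet => ?_, isHamburgerDeterminate_of_not_eval_sq_le hμ hpos⟩
  rintro ⟨ε, hε, h⟩
  exact not_isHamburgerDeterminate_of_eval_sq_le hμ hx hε h hdet
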